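/- **Theorem.** Let $\lambda>0$, $c>0$ and $p,q\ge 0$ with $p+q=1$. A particle starts at the origin of the plane and moves at constant speed $c$; its initial direction is uniformly distributed on the four directions $d_j=(\cos\frac{\pi j}{2},\sin\frac{\pi j}{2})$, $j\in\mathbb Z/4\mathbb Z$. At the arrival times of a homogeneous Poisson process of intensity $\lambda$ the direction changes: independently of everything else, with probability $p$ from $d_j$ to $d_{j+1}$ (counter-clockwise turn) and with probability $q$ from $d_j$ to $d_{j-1}$ (clockwise turn), so that reversals $d_j\to d_{j+2}$ do not occur. Let $(X(t),Y(t))$ be the position at time $t$. For $\alpha,\beta\in\mathbb R$ put (principal square roots of complex numbers) $$A=\tfrac12\sqrt{4\lambda^2p(1-p)-c^2(\alpha^2+\beta^2)+2\sqrt{c^4\alpha^2\beta^2-\lambda^4(2p-1)^2}},$$ $$B=\tfrac12\sqrt{4\lambda^2p(1-p)-c^2(\alpha^2+\beta^2)-2\sqrt{c^4\alpha^2\beta^2-\lambda^4(2p-1)^2}},$$ $$k_0=\frac{2\lambda^2-c^2(\alpha^2+\beta^2)-2(A-B)^2}{8AB},\qquad k_1=\frac{\lambda^3-\lambda c^2(\alpha^2+\beta^2)-\lambda(A-B)^2}{4AB(A+B)},$$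 $$k_2=\frac{2\lambda^2-c^2(\alpha^2+\beta^2)-2(A+B)^2}{8AB},\qquad k_3=\frac{\lambda^3-\lambda c^2(\alpha^2+\beta^2)-\lambda(A+B)^2}{4AB(A-B)}.$$ Then for every $t\ge0$ and all $(\alpha,\beta)$ with $A\ne0$, $B\ne0$ and $A\neq\pm B$, $$\mathbb E\big[e^{i(\alpha X(t)+\beta Y(t))}\big]=e^{-\lambda t}\Big\{k_0\cosh\big((A+B)t\big)+k_1\sinh\big((A+B)t\big)-k_2\cosh\big((A-B)t\big)-k_3\sinh\big((A-B)t\big)\Big\}.$$ The set of these pairs $(\alpha,\beta)$ is dense in $\mathbb R^2$, and for every $t\ge 0$ and every $(\alpha_0,\beta_0)\in\mathbb R^2$ the right-hand side converges to $\mathbb E[e^{i(\alpha_0X(t)+\beta_0Y(t))}]$ as $(\alpha,\beta)\to(\alpha_0,\beta_0)$ along such pairs; so at the exceptional pairs the formula holds with its right-hand side read as this limit. -/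

import Mathlib

open MeasureTheory ProbabilityTheory Filter Topology

noncomputable section

/-- The random ingredients of the planar motion with orthogonal directions: the initial direction
`J₀` (the index of `d_j`, modulo `4`), the successive turns `turn 0, turn 1, …` and the successive
waiting times `τ 0, τ 1, …` between changes of direction.

* the waiting times are i.i.d. exponential of rate `lam` (so that the changes of direction occur at
  the arrival times of a homogeneous Poisson process of intensity `lam`);
* the initial direction is uniform on the four directions;
* the turns are i.i.d.: `+1` (counter-clockwise) with probability `p`, `-1` (clockwise) with
  probability `q`, `2` (reflection) with probability `1 - p - q`;
* waiting times, turns and initial direction are independent. -/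
structure IsPlanarMotionData {Ω : Type*} [MeasurableSpace Ω] (μ : Measure Ω) (p q lam : ℝ)
    (J₀ : Ω → ZMod 4) (turn : ℕ → Ω → ZMod 4) (τ : ℕ → Ω → ℝ) : Prop where
  measurable_init : Measurable J₀
  measurable_turn : ∀ n, Measurable (turn n)
  measurable_wait : ∀ n, Measurable (τ n)
  init_law : ∀ j : ZMod 4, μ.real {ω | J₀ ω = j} = 1 / 4
  turn_ccw : ∀ n, μ.real {ω | turn n ω = 1} = p
  turn_cw : ∀ n, μ.real {ω | turn n ω = -1} = q
  turn_refl : ∀ n, μ.real {ω | turn n ω = 2} = 1 - p - q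
  wait_law : ∀ n, μ.map (τ n) = expMeasure lam
  indep_turn : iIndepFun turn μ
  indep_wait : iIndepFun τ μ
  indep_init_turn : IndepFun J₀ (fun ω n => turn n ω) μ
  indep_wait_dir : IndepFun (fun ω n => τ n ω) (fun ω => (J₀ ω, fun n => turn n ω)) μ

section Motion

variable {Ω : Type*}

/-- The time of the `(n + 1)`-st change of direction. -/
def arrivalTime (τ : ℕ → Ω → ℝ) (n : ℕ) (ω : Ω) : ℝ :=
  ∑ k ∈ Finset.range (n + 1), τ k ω

/-- `N(t)`: the number of changes of direction up to time `t`. -/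
def numChanges (τ : ℕ → Ω → ℝ) (t : ℝ) (ω : Ω) : ℕ :=
  {n : ℕ | arrivalTime τ n ω ≤ t}.ncard

/-- The index modulo `4` of the direction `D(t)` at time `t`. -/
def dirIndex (J₀ : Ω → ZMod 4) (turn : ℕ → Ω → ZMod 4) (τ : ℕ → Ω → ℝ) (t : ℝ) (ω : Ω) : ZMod 4 :=
  J₀ ω + ∑ k ∈ Finset.range (numChanges τ t ω), turn k ω

/-- The direction `d_j = (cos (π j / 2), sin (π j / 2))`, `j = 0, 1, 2, 3`. -/
def direction (j : ZMod 4) : ℝ × ℝ :=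
  (Real.cos (Real.pi / 2 * (j.val : ℝ)), Real.sin (Real.pi / 2 * (j.val : ℝ)))

/-- The abscissa `X(t)` of the particle that starts at the origin and moves at speed `c` along
the current direction. -/
def posX (c : ℝ) (J₀ : Ω → ZMod 4) (turn : ℕ → Ω → ZMod 4) (τ : ℕ → Ω → ℝ) (t : ℝ) (ω : Ω) : ℝ :=
  ∫ s in (0 : ℝ)..t, c * (direction (dirIndex J₀ turn τ s ω)).1

/-- The ordinate `Y(t)` of the particle. -/
def posY (c : ℝ) (J₀ : Ω → ZMod 4) (turn : ℕ → Ω → ZMod 4) (τ : ℕ → Ω → ℝ) (t : ℝ) (ω : Ω) : ℝ :=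
  ∫ s in (0 : ℝ)..t, c * (direction (dirIndex J₀ turn τ s ω)).2

/-- `E[exp (i (α X(t) + β Y(t)))]`. -/
def motionCharFun [MeasurableSpace Ω] (μ : Measure Ω) (c : ℝ) (J₀ : Ω → ZMod 4)
    (turn : ℕ → Ω → ZMod 4) (τ : ℕ → Ω → ℝ) (α β t : ℝ) : ℂ :=
  ∫ ω, Complex.exp (Complex.I *
    ((α * posX c J₀ turn τ t ω + β * posY c J₀ turn τ t ω : ℝ) : ℂ)) ∂μ

end Motion

/-- The principal square root of a complex number. -/
def csqrt (z : ℂ) : ℂ := z ^ (1 / 2 : ℂ)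

/-- `A(α, β)`. -/
def coeffA (p lam c α β : ℝ) : ℂ :=
  1 / 2 * csqrt (4 * lam ^ 2 * p * (1 - p) - c ^ 2 * (α ^ 2 + β ^ 2)
    + 2 * csqrt (c ^ 4 * α ^ 2 * β ^ 2 - lam ^ 4 * (2 * p - 1) ^ 2))

/-- `B(α, β)`. -/
def coeffB (p lam c α β : ℝ) : ℂ :=
  1 / 2 * csqrt (4 * lam ^ 2 * p * (1 - p) - c ^ 2 * (α ^ 2 + β ^ 2)
    - 2 * csqrt (c ^ 4 * α ^ 2 * β ^ 2 - lam ^ 4 * (2 * p - 1) ^ 2))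

/-- `k₀(α, β)`. -/
def coeffK0 (p lam c α β : ℝ) : ℂ :=
  (2 * lam ^ 2 - c ^ 2 * (α ^ 2 + β ^ 2) - 2 * (coeffA p lam c α β - coeffB p lam c α β) ^ 2)
    / (8 * coeffA p lam c α β * coeffB p lam c α β)

/-- `k₁(α, β)`. -/
def coeffK1 (p lam c α β : ℝ) : ℂ :=
  (lam ^ 3 - lam * c ^ 2 * (α ^ 2 + β ^ 2)
      - lam * (coeffA p lam c α β - coeffB p lam c α β) ^ 2)
    / (4 * coeffA p lam c α β * coeffB p lam c α β
      * (coeffA p lam c α β + coeffB p lam c α β))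

/-- `k₂(α, β)`. -/
def coeffK2 (p lam c α β : ℝ) : ℂ :=
  (2 * lam ^ 2 - c ^ 2 * (α ^ 2 + β ^ 2) - 2 * (coeffA p lam c α β + coeffB p lam c α β) ^ 2)
    / (8 * coeffA p lam c α β * coeffB p lam c α β)

/-- `k₃(α, β)`. -/
def coeffK3 (p lam c α β : ℝ) : ℂ :=
  (lam ^ 3 - lam * c ^ 2 * (α ^ 2 + β ^ 2)
      - lam * (coeffA p lam c α β + coeffB p lam c α β) ^ 2)
    / (4 * coeffA p lam c α β * coeffB p lam c α β
      * (coeffA p lam c α β - coeffB p lam c α β))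

/-- The explicit expression of the characteristic function without reflection. -/
def explicitCharFun (p lam c α β t : ℝ) : ℂ :=
  Complex.exp (-(lam * t)) *
    (coeffK0 p lam c α β * Complex.cosh (coeffA p lam c α β * t + coeffB p lam c α β * t)
      + coeffK1 p lam c α β * Complex.sinh (coeffA p lam c α β * t + coeffB p lam c α β * t)
      - coeffK2 p lam c α β * Complex.cosh (coeffA p lam c α β * t - coeffB p lam c α β * t)
      - coeffK3 p lam c α β * Complex.sinh (coeffA p lam c α β * t - coeffB p lam c α β * t))

/-- The pairs `(α, β)` at which none of the denominators of `k₀, k₁, k₂, k₃` vanishes. -/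
def regularPairs (p lam c : ℝ) : Set (ℝ × ℝ) :=
  {z | coeffA p lam c z.1 z.2 ≠ 0 ∧ coeffB p lam c z.1 z.2 ≠ 0 ∧
    coeffA p lam c z.1 z.2 + coeffB p lam c z.1 z.2 ≠ 0 ∧
    coeffA p lam c z.1 z.2 - coeffB p lam c z.1 z.2 ≠ 0}

end

/-! Let `v j` be the rate at which the phase `α X + β Y` grows while the direction is `j`.
Conditioning on the first change of direction suggests that the conditional characteristic functions
`U j`, given the initial direction `j`, solve the linear system of `IsBackwardSolution`, that is `U
t = exp (-lam t) exp (t G) 1` with `G` the operator `phaseGenerator`. Opposite directions have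
opposite velocities, so the characteristic polynomial of `G` is even: `G⁴ = a G² - b`
(`generator_cayley`, for the vector `1`). The roots of `z⁴ - a z² + b` are `±(A + B)` and `±(A -
B)`. Hence `exp (t G) 1` is a combination of `G^k 1`, `k < 4`, with hyperbolic coefficients
`fundSol`, and averaging over `j` gives the stated formula (`average_dirCharFun`).

The probabilistic half takes any solution `U` and identifies its average with the characteristic
function, without a uniqueness theorem. Stop the path at its `n`-th change of direction: if time `t`
has been passed, record the true value of `exp (i Θ(t))`, otherwise the prediction `exp (i V) U d (t
- T)` from the current state. One step leaves the mean unchanged, by Duhamel's formula and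
independence (`IsPlanarMotionData.integral_step`). The jump times tend to infinity, so the recorded
value is eventually exact, and dominated convergence concludes
(`IsPlanarMotionData.motionCharFun_eq`).

The excluded pairs lie on the zero sets of two polynomials, whence density; the limit statement is
continuity of the characteristic function. -/

/-! ### Paths described by waiting times and turns. -/

/-- The time of the `n`-th change of direction, for waiting times `s`; the motion starts at
`jumpTime s 0 = 0`. -/
def jumpTime (s : ℕ → ℝ) (n : ℕ) : ℝ := ∑ k ∈ Finset.range n, s k

/-- The direction index after `n` changes of direction. -/
def jumpDir (j : ZMod 4) (u : ℕ → ZMod 4) (n : ℕ) : ZMod 4 := j + ∑ k ∈ Finset.range n, u k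

/-- The integral of `g` along the direction process up to the `n`-th change of direction. -/
def jumpPhase (g : ZMod 4 → ℝ) (j : ZMod 4) (u : ℕ → ZMod 4) (s : ℕ → ℝ) (n : ℕ) : ℝ :=
  ∑ k ∈ Finset.range n, g (jumpDir j u k) * s k

theorem jumpTime_zero (s : ℕ → ℝ) : jumpTime s 0 = 0 := by simp [jumpTime]

theorem jumpTime_succ (s : ℕ → ℝ) (n : ℕ) : jumpTime s (n + 1) = jumpTime s n + s n := by
  simp [jumpTime, Finset.sum_range_succ]

theorem jumpDir_zero (j : ZMod 4) (u : ℕ → ZMod 4) : jumpDir j u 0 = j := by simp [jumpDir]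

theorem jumpDir_succ (j : ZMod 4) (u : ℕ → ZMod 4) (n : ℕ) :
    jumpDir j u (n + 1) = jumpDir j u n + u n := by
  simp [jumpDir, Finset.sum_range_succ, add_assoc]

theorem jumpPhase_zero (g : ZMod 4 → ℝ) (j : ZMod 4) (u : ℕ → ZMod 4) (s : ℕ → ℝ) :
    jumpPhase g j u s 0 = 0 := by simp [jumpPhase]

theorem jumpPhase_succ (g : ZMod 4 → ℝ) (j : ZMod 4) (u : ℕ → ZMod 4) (s : ℕ → ℝ) (n : ℕ) :
    jumpPhase g j u s (n + 1) = jumpPhase g j u s n + g (jumpDir j u n) * s n := by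
  simp [jumpPhase, Finset.sum_range_succ]

theorem jumpTime_mono {s : ℕ → ℝ} (hs : ∀ n, 0 ≤ s n) : Monotone (jumpTime s) :=
  monotone_nat_of_le_succ fun n => by rw [jumpTime_succ]; linarith [hs n]

theorem jumpTime_nonneg {s : ℕ → ℝ} (hs : ∀ n, 0 ≤ s n) (n : ℕ) : 0 ≤ jumpTime s n :=
  Finset.sum_nonneg fun k _ => hs k

/-- The jump times increase to infinity, so every time lies between two consecutive ones. -/
theorem exists_jumpTime_le_lt {s : ℕ → ℝ} (hlim : Tendsto (jumpTime s) atTop atTop)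
    {t : ℝ} (ht : 0 ≤ t) : ∃ n, jumpTime s n ≤ t ∧ t < jumpTime s (n + 1) := by
  by_contra! h
  have hall : ∀ n, jumpTime s n ≤ t := by
    intro n
    induction n with
    | zero => rwa [jumpTime_zero]
    | succ n ih => exact h n ih
  obtain ⟨n, hn⟩ := (hlim.eventually_gt_atTop t).exists
  exact absurd (hall n) (not_le.2 hn)

section Path

variable {Ω : Type*} {τ : ℕ → Ω → ℝ} {ω : Ω}

theorem numChanges_eq_of_mem (hs : ∀ n, 0 ≤ τ n ω) {t : ℝ} {n : ℕ}
    (h1 : jumpTime (fun k => τ k ω) n ≤ t) (h2 : t < jumpTime (fun k => τ k ω) (n + 1)) :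
    numChanges τ t ω = n := by
  have hset : {m : ℕ | arrivalTime τ m ω ≤ t} = ↑(Finset.range n) := by
    ext m
    -- `arrivalTime` with index `m` is the jump time with index `m + 1`, so the indices counted are
    -- exactly those below `n`.
    change jumpTime (fun k => τ k ω) (m + 1) ≤ t ↔ m ∈ (↑(Finset.range n) : Set ℕ)
    rw [Finset.mem_coe, Finset.mem_range]
    constructor
    · intro hm
      by_contra! hc
      have := jumpTime_mono hs (Nat.succ_le_succ hc)
      exact absurd (h2.trans_le this) (not_lt.2 hm)
    · intro hm
      exact (jumpTime_mono hs hm).trans h1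
  rw [numChanges, hset, Set.ncard_coe_finset, Finset.card_range]

theorem dirIndex_eq_of_mem (J₀ : Ω → ZMod 4) (turn : ℕ → Ω → ZMod 4) (hs : ∀ n, 0 ≤ τ n ω)
    {t : ℝ} {n : ℕ} (h1 : jumpTime (fun k => τ k ω) n ≤ t)
    (h2 : t < jumpTime (fun k => τ k ω) (n + 1)) :
    dirIndex J₀ turn τ t ω = jumpDir (J₀ ω) (fun k => turn k ω) n := by
  rw [dirIndex, numChanges_eq_of_mem hs h1 h2, jumpDir]

theorem integral_dirIndex_between (g : ZMod 4 → ℝ) (J₀ : Ω → ZMod 4) (turn : ℕ → Ω → ZMod 4)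
    (hs : ∀ n, 0 ≤ τ n ω) {n : ℕ} {b : ℝ}
    (h1 : jumpTime (fun k => τ k ω) n ≤ b) (h2 : b ≤ jumpTime (fun k => τ k ω) (n + 1)) :
    IntervalIntegrable (fun r => g (dirIndex J₀ turn τ r ω)) volume
        (jumpTime (fun k => τ k ω) n) b ∧
      ∫ r in (jumpTime (fun k => τ k ω) n)..b, g (dirIndex J₀ turn τ r ω)
        = g (jumpDir (J₀ ω) (fun k => turn k ω) n) * (b - jumpTime (fun k => τ k ω) n) := by
  -- The interval is open because the direction may already have changed at `b`; the endpoints are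
  -- negligible for the integral.
  have hEq : Set.EqOn (fun _ => g (jumpDir (J₀ ω) (fun k => turn k ω) n))
      (fun r => g (dirIndex J₀ turn τ r ω)) (Set.Ioo (jumpTime (fun k => τ k ω) n) b) := by
    intro r hr
    simp only
    rw [dirIndex_eq_of_mem J₀ turn hs hr.1.le (hr.2.trans_le h2)]
  constructor
  · rw [intervalIntegrable_iff_integrableOn_Ioo_of_le h1]
    refine IntegrableOn.congr_fun ?_ hEq measurableSet_Ioo
    exact integrableOn_const (by simp)
  · rw [intervalIntegral.integral_of_le h1, integral_Ioc_eq_integral_Ioo,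
      ← setIntegral_congr_fun measurableSet_Ioo hEq, setIntegral_const]
    simp [h1, mul_comm]

theorem integral_dirIndex_jumpTime (g : ZMod 4 → ℝ) (J₀ : Ω → ZMod 4)
    (turn : ℕ → Ω → ZMod 4) (hs : ∀ n, 0 ≤ τ n ω) (n : ℕ) :
    IntervalIntegrable (fun r => g (dirIndex J₀ turn τ r ω)) volume 0
        (jumpTime (fun k => τ k ω) n) ∧
      ∫ r in (0 : ℝ)..(jumpTime (fun k => τ k ω) n), g (dirIndex J₀ turn τ r ω)
        = jumpPhase g (J₀ ω) (fun k => turn k ω) (fun k => τ k ω) n := by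
  induction n with
  | zero => simp [jumpTime_zero, jumpPhase_zero]
  | succ n ih =>
    obtain ⟨hi, he⟩ := integral_dirIndex_between g J₀ turn hs
      (jumpTime_mono hs n.le_succ) le_rfl
    refine ⟨ih.1.trans hi, ?_⟩
    rw [← intervalIntegral.integral_add_adjacent_intervals ih.1 hi, ih.2, he, jumpPhase_succ,
      jumpTime_succ, add_sub_cancel_left]

theorem integral_dirIndex (g : ZMod 4 → ℝ) (J₀ : Ω → ZMod 4) (turn : ℕ → Ω → ZMod 4)
    (hs : ∀ n, 0 ≤ τ n ω) {t : ℝ} {n : ℕ} (h1 : jumpTime (fun k => τ k ω) n ≤ t)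
    (h2 : t < jumpTime (fun k => τ k ω) (n + 1)) :
    ∫ r in (0 : ℝ)..t, g (dirIndex J₀ turn τ r ω)
      = jumpPhase g (J₀ ω) (fun k => turn k ω) (fun k => τ k ω) n
        + g (jumpDir (J₀ ω) (fun k => turn k ω) n) * (t - jumpTime (fun k => τ k ω) n) := by
  obtain ⟨hi, he⟩ := integral_dirIndex_between g J₀ turn hs h1 h2.le
  obtain ⟨hi', he'⟩ := integral_dirIndex_jumpTime g J₀ turn hs n
  rw [← intervalIntegral.integral_add_adjacent_intervals hi' hi, he', he]

/-- The component of the velocity in direction `j` along `(α, β)`. -/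
noncomputable def projVelocity (c α β : ℝ) (j : ZMod 4) : ℝ :=
  α * (c * (direction j).1) + β * (c * (direction j).2)

theorem proj_pos_eq (c α β : ℝ) (J₀ : Ω → ZMod 4) (turn : ℕ → Ω → ZMod 4)
    (hs : ∀ n, 0 ≤ τ n ω) {t : ℝ} {n : ℕ} (h1 : jumpTime (fun k => τ k ω) n ≤ t)
    (h2 : t < jumpTime (fun k => τ k ω) (n + 1)) :
    α * posX c J₀ turn τ t ω + β * posY c J₀ turn τ t ω
      = jumpPhase (projVelocity c α β) (J₀ ω) (fun k => turn k ω) (fun k => τ k ω) n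
        + projVelocity c α β (jumpDir (J₀ ω) (fun k => turn k ω) n)
          * (t - jumpTime (fun k => τ k ω) n) := by
  rw [posX, posY, integral_dirIndex (fun j => c * (direction j).1) J₀ turn hs h1 h2,
    integral_dirIndex (fun j => c * (direction j).2) J₀ turn hs h1 h2]
  simp only [jumpPhase, projVelocity, mul_add, Finset.mul_sum, add_mul, Finset.sum_add_distrib]
  ring_nf

end Path

/-! ### Algebra of the generator and explicit solution of the backward system. -/

noncomputable section

theorem direction_zero : direction 0 = (1, 0) := by simp [direction]

theorem direction_one : direction 1 = (0, 1) := by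
  have : (1 : ZMod 4).val = 1 := rfl
  simp [direction, this]

theorem direction_two : direction 2 = (-1, 0) := by
  have : (2 : ZMod 4).val = 2 := rfl
  have h : Real.pi / 2 * 2 = Real.pi := by ring
  simp [direction, this, h]

theorem direction_three : direction 3 = (0, -1) := by
  have : (3 : ZMod 4).val = 3 := rfl
  have h : Real.pi / 2 * 3 = Real.pi + Real.pi / 2 := by ring
  simp [direction, this, h, Real.cos_add, Real.sin_add]

/-- The generator of the direction process together with multiplication by the phase velocity. -/
def phaseGenerator (p q lam : ℝ) (v : ZMod 4 → ℝ) (w : ZMod 4 → ℂ) (j : ZMod 4) : ℂ :=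
  Complex.I * v j * w j + lam * (p * w (j + 1) + q * w (j - 1))

theorem projVelocity_values (c α β : ℝ) :
    projVelocity c α β 0 = c * α ∧ projVelocity c α β 1 = c * β ∧
      projVelocity c α β 2 = -(c * α) ∧ projVelocity c α β 3 = -(c * β) := by
  refine ⟨?_, ?_, ?_, ?_⟩ <;>
    simp [projVelocity, direction_zero, direction_one, direction_two, direction_three, mul_comm]

/-- The iterates of the generator on the constant function `1`. -/
def generatorIterate (p q lam c α β : ℝ) (n : ℕ) : ZMod 4 → ℂ :=
  (phaseGenerator p q lam (projVelocity c α β))^[n] 1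

theorem generatorIterate_succ (p q lam c α β : ℝ) (n : ℕ) :
    generatorIterate p q lam c α β (n + 1)
      = phaseGenerator p q lam (projVelocity c α β) (generatorIterate p q lam c α β n) :=
  Function.iterate_succ_apply' _ _ _

theorem sum_zmod_four (f : ZMod 4 → ℂ) : ∑ j, f j = f 0 + f 1 + f 2 + f 3 :=
  Fin.sum_univ_four f

/-- Cayley–Hamilton for the four-by-four generator, applied to the vector `1`. The odd coefficients
vanish because the map `w j ↦ (-1)^j w (j + 2)` anticommutes with the generator: shifting by two
reverses the velocity, and alternating signs reverse the turning term. -/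
theorem generator_cayley (p lam c α β : ℝ) (j : ZMod 4) :
    generatorIterate p (1 - p) lam c α β 4 j
      = (4 * lam ^ 2 * p * (1 - p) - c ^ 2 * (α ^ 2 + β ^ 2))
          * generatorIterate p (1 - p) lam c α β 2 j
        - (c ^ 4 * α ^ 2 * β ^ 2 - lam ^ 4 * (2 * p - 1) ^ 2) := by
  obtain ⟨h0, h1, h2, h3⟩ := projVelocity_values c α β
  have e1 : (1 : ZMod 4) + 1 = 2 := rfl
  have e2 : (2 : ZMod 4) + 1 = 3 := rfl
  have e3 : (3 : ZMod 4) + 1 = 0 := rfl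
  have e4 : (0 : ZMod 4) - 1 = 3 := rfl
  have e5 : (2 : ZMod 4) - 1 = 1 := rfl
  have e6 : (3 : ZMod 4) - 1 = 2 := rfl
  have hI2 : Complex.I ^ 2 = -1 := Complex.I_sq
  have hI3 : Complex.I ^ 3 = -Complex.I := Complex.I_pow_three
  have hI4 : Complex.I ^ 4 = 1 := Complex.I_pow_four
  have hj : j = 0 ∨ j = 1 ∨ j = 2 ∨ j = 3 := by revert j; decide
  rcases hj with rfl | rfl | rfl | rfl <;>
  · simp only [generatorIterate, Function.iterate_succ, Function.iterate_zero, Function.comp,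
      id, phaseGenerator, zero_add, sub_self, e1, e2, e3, e4, e5, e6, h0, h1, h2, h3, Pi.one_apply]
    push_cast
    ring_nf
    simp only [hI2, hI3, hI4]
    ring

/-- The parameter `p` drops out: summing over `j` erases the split between the two turns, and the
products of velocities of neighbouring directions cancel. -/
theorem generator_averages (p lam c α β : ℝ) :
    (∑ j, generatorIterate p (1 - p) lam c α β 0 j = 4) ∧
    (∑ j, generatorIterate p (1 - p) lam c α β 1 j = 4 * lam) ∧
    (∑ j, generatorIterate p (1 - p) lam c α β 2 j
      = 4 * lam ^ 2 - 2 * c ^ 2 * (α ^ 2 + β ^ 2)) ∧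
    (∑ j, generatorIterate p (1 - p) lam c α β 3 j
      = 4 * lam ^ 3 - 4 * lam * c ^ 2 * (α ^ 2 + β ^ 2)) := by
  obtain ⟨h0, h1, h2, h3⟩ := projVelocity_values c α β
  have e1 : (1 : ZMod 4) + 1 = 2 := rfl
  have e2 : (2 : ZMod 4) + 1 = 3 := rfl
  have e3 : (3 : ZMod 4) + 1 = 0 := rfl
  have e4 : (0 : ZMod 4) - 1 = 3 := rfl
  have e5 : (2 : ZMod 4) - 1 = 1 := rfl
  have e6 : (3 : ZMod 4) - 1 = 2 := rfl
  have hI2 : Complex.I ^ 2 = -1 := Complex.I_sq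
  refine ⟨?_, ?_, ?_, ?_⟩ <;>
  · rw [sum_zmod_four]
    simp only [generatorIterate, Function.iterate_succ, Function.iterate_zero, Function.comp,
      id, phaseGenerator, zero_add, sub_self, e1, e2, e3, e4, e5, e6, h0, h1, h2, h3, Pi.one_apply]
    push_cast
    ring_nf
    try simp only [hI2]
    try ring

/-- This is the only property of the square root that is used, so the choice of branch plays no
role. -/
theorem csqrt_sq (z : ℂ) : csqrt z ^ 2 = z := by
  have := Complex.cpow_nat_inv_pow z (n := 2) (by norm_num)
  rw [csqrt, one_div]
  exact_mod_cast this

theorem coeffA_sq (p lam c α β : ℝ) : 4 * coeffA p lam c α β ^ 2 =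
    4 * lam ^ 2 * p * (1 - p) - c ^ 2 * (α ^ 2 + β ^ 2)
    + 2 * csqrt (c ^ 4 * α ^ 2 * β ^ 2 - lam ^ 4 * (2 * p - 1) ^ 2) := by
  rw [coeffA, mul_pow, csqrt_sq]; ring

theorem coeffB_sq (p lam c α β : ℝ) : 4 * coeffB p lam c α β ^ 2 =
    4 * lam ^ 2 * p * (1 - p) - c ^ 2 * (α ^ 2 + β ^ 2)
    - 2 * csqrt (c ^ 4 * α ^ 2 * β ^ 2 - lam ^ 4 * (2 * p - 1) ^ 2) := by
  rw [coeffB, mul_pow, csqrt_sq]; ring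

/-- The sum of the squares of `A + B` and `A - B`. -/
theorem sq_add_sq_coeff (p lam c α β : ℝ) :
    (coeffA p lam c α β + coeffB p lam c α β) ^ 2 + (coeffA p lam c α β - coeffB p lam c α β) ^ 2
      = 4 * lam ^ 2 * p * (1 - p) - c ^ 2 * (α ^ 2 + β ^ 2) := by
  linear_combination (coeffA_sq p lam c α β + coeffB_sq p lam c α β) / 2

theorem sq_mul_sq_coeff (p lam c α β : ℝ) :
    (coeffA p lam c α β + coeffB p lam c α β) ^ 2 * (coeffA p lam c α β - coeffB p lam c α β) ^ 2
      = c ^ 4 * α ^ 2 * β ^ 2 - lam ^ 4 * (2 * p - 1) ^ 2 := by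
  have h : coeffA p lam c α β ^ 2 - coeffB p lam c α β ^ 2
      = csqrt (c ^ 4 * α ^ 2 * β ^ 2 - lam ^ 4 * (2 * p - 1) ^ 2) := by
    linear_combination (coeffA_sq p lam c α β - coeffB_sq p lam c α β) / 4
  rw [← csqrt_sq (c ^ 4 * α ^ 2 * β ^ 2 - lam ^ 4 * (2 * p - 1) ^ 2), ← h]
  ring

/-- The fundamental solutions of the scalar equation `f'''' = (x² + y²) f'' - x² y² f`. -/
def fundSol (x y : ℂ) : Fin 4 → ℝ → ℂ
  | 0, t => (x ^ 2 * Complex.cosh (y * t) - y ^ 2 * Complex.cosh (x * t)) / (x ^ 2 - y ^ 2)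
  | 1, t => (x ^ 2 * (Complex.sinh (y * t) / y) - y ^ 2 * (Complex.sinh (x * t) / x))
      / (x ^ 2 - y ^ 2)
  | 2, t => (Complex.cosh (x * t) - Complex.cosh (y * t)) / (x ^ 2 - y ^ 2)
  | 3, t => (Complex.sinh (x * t) / x - Complex.sinh (y * t) / y) / (x ^ 2 - y ^ 2)

theorem hasDerivAt_cosh_mul (x : ℂ) (t : ℝ) :
    HasDerivAt (fun r : ℝ => Complex.cosh (x * r)) (x * Complex.sinh (x * t)) t := by
  have h := ((hasDerivAt_id (t : ℂ)).const_mul x).ccosh.comp_ofReal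
  simpa [mul_comm] using h

theorem hasDerivAt_sinh_mul (x : ℂ) (t : ℝ) :
    HasDerivAt (fun r : ℝ => Complex.sinh (x * r)) (x * Complex.cosh (x * t)) t := by
  have h := ((hasDerivAt_id (t : ℂ)).const_mul x).csinh.comp_ofReal
  simpa [mul_comm] using h

/-- These are the equations of the companion matrix: they say that `∑ f_k G^k` has derivative `G ∑
f_k G^k` whenever `G⁴ = (x² + y²) G² - x² y²`. -/
theorem hasDerivAt_fundSol {x y : ℂ} (hx : x ≠ 0) (hy : y ≠ 0) (hxy : x ^ 2 - y ^ 2 ≠ 0)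
    (t : ℝ) :
    HasDerivAt (fundSol x y 0) (-(x ^ 2 * y ^ 2) * fundSol x y 3 t) t ∧
    HasDerivAt (fundSol x y 1) (fundSol x y 0 t) t ∧
    HasDerivAt (fundSol x y 2) (fundSol x y 1 t + (x ^ 2 + y ^ 2) * fundSol x y 3 t) t ∧
    HasDerivAt (fundSol x y 3) (fundSol x y 2 t) t := by
  have cx := hasDerivAt_cosh_mul x t
  have cy := hasDerivAt_cosh_mul y t
  have sx := hasDerivAt_sinh_mul x t
  have sy := hasDerivAt_sinh_mul y t
  refine ⟨?_, ?_, ?_, ?_⟩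
  · refine (((cy.const_mul (x ^ 2)).sub (cx.const_mul (y ^ 2))).div_const
      (x ^ 2 - y ^ 2)).congr_deriv ?_
    simp only [fundSol]; field_simp; ring
  · refine ((((sy.div_const y).const_mul (x ^ 2)).sub
      ((sx.div_const x).const_mul (y ^ 2))).div_const (x ^ 2 - y ^ 2)).congr_deriv ?_
    simp only [fundSol]; field_simp
  · refine ((cx.sub cy).div_const (x ^ 2 - y ^ 2)).congr_deriv ?_
    simp only [fundSol]; field_simp; ring
  · refine (((sx.div_const x).sub (sy.div_const y)).div_const (x ^ 2 - y ^ 2)).congr_deriv ?_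
    simp only [fundSol]; field_simp

/-- The conditional characteristic functions given the initial direction. -/
def dirCharFun (p lam c α β : ℝ) (j : ZMod 4) (t : ℝ) : ℂ :=
  Complex.exp (-lam * t) * ∑ k : Fin 4,
    fundSol (coeffA p lam c α β + coeffB p lam c α β) (coeffA p lam c α β - coeffB p lam c α β) k t
      * generatorIterate p (1 - p) lam c α β k j

theorem sq_sub_sq_coeff_ne_zero {p lam c α β : ℝ} (h : (α, β) ∈ regularPairs p lam c) :
    (coeffA p lam c α β + coeffB p lam c α β) ^ 2
      - (coeffA p lam c α β - coeffB p lam c α β) ^ 2 ≠ 0 := by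
  obtain ⟨hA, hB, -, -⟩ := h
  have : (coeffA p lam c α β + coeffB p lam c α β) ^ 2
      - (coeffA p lam c α β - coeffB p lam c α β) ^ 2
      = 4 * (coeffA p lam c α β * coeffB p lam c α β) := by ring
  rw [this]
  exact mul_ne_zero (by norm_num) (mul_ne_zero hA hB)

theorem dirCharFun_zero {p lam c α β : ℝ} (h : (α, β) ∈ regularPairs p lam c) (j : ZMod 4) :
    dirCharFun p lam c α β j 0 = 1 := by
  have hne := sq_sub_sq_coeff_ne_zero h
  simp [dirCharFun, Fin.sum_univ_four, fundSol, generatorIterate, div_self hne]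

theorem hasDerivAt_dirCharFun {p lam c α β : ℝ} (h : (α, β) ∈ regularPairs p lam c)
    (j : ZMod 4) (t : ℝ) :
    HasDerivAt (dirCharFun p lam c α β j)
      ((Complex.I * projVelocity c α β j - lam) * dirCharFun p lam c α β j t
        + lam * (p * dirCharFun p lam c α β (j + 1) t
          + (1 - p) * dirCharFun p lam c α β (j - 1) t)) t := by
  have hne := sq_sub_sq_coeff_ne_zero h
  have hcay := generator_cayley p lam c α β j
  rw [← sq_add_sq_coeff, ← sq_mul_sq_coeff] at hcay
  obtain ⟨d0, d1, d2, d3⟩ := hasDerivAt_fundSol h.2.2.1 h.2.2.2 hne t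
  have he : HasDerivAt (fun r : ℝ => Complex.exp (-lam * r))
      (-lam * Complex.exp (-lam * t)) t := by
    have := ((hasDerivAt_id (t : ℂ)).const_mul (-lam : ℂ)).cexp.comp_ofReal
    simpa [mul_comm] using this
  have hsum := (((d0.mul_const (generatorIterate p (1 - p) lam c α β 0 j)).add
    (d1.mul_const (generatorIterate p (1 - p) lam c α β 1 j))).add
    (d2.mul_const (generatorIterate p (1 - p) lam c α β 2 j))).add
    (d3.mul_const (generatorIterate p (1 - p) lam c α β 3 j))
  have key := he.mul hsum
  have g1 := congrFun (generatorIterate_succ p (1 - p) lam c α β 0) j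
  have g2 := congrFun (generatorIterate_succ p (1 - p) lam c α β 1) j
  have g3 := congrFun (generatorIterate_succ p (1 - p) lam c α β 2) j
  have g4 := congrFun (generatorIterate_succ p (1 - p) lam c α β 3) j
  have g0 : generatorIterate p (1 - p) lam c α β 0 j = 1 := rfl
  refine (key.congr_of_eventuallyEq (Eventually.of_forall fun r => ?_)).congr_deriv ?_
  · simp only [dirCharFun, Fin.sum_univ_four]
    rfl
  · simp only [dirCharFun, Fin.sum_univ_four]
    simp only [phaseGenerator, zero_add, Nat.reduceAdd] at g1 g2 g3 g4
    rw [hcay] at g4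
    push_cast at g1 g2 g3 g4
    simp only [Fin.val_zero, Fin.val_one, Fin.val_two, show ((3 : Fin 4) : ℕ) = 3 from rfl,
      Pi.add_apply]
    generalize fundSol _ _ 0 t = f0
    generalize fundSol _ _ 1 t = f1
    generalize fundSol _ _ 2 t = f2
    generalize hf3 : fundSol _ _ 3 t = f3
    generalize Complex.exp (-lam * t) = e
    generalize (coeffA p lam c α β + coeffB p lam c α β) = x at *
    generalize (coeffA p lam c α β - coeffB p lam c α β) = y at *
    -- Each `f_k` multiplies the recursion producing the iterate `k + 1`. The fourth iterate has
    -- been rewritten by the Cayley–Hamilton relation, whose constant term is matched with the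
    -- zeroth iterate through `g0`.
    linear_combination e * (f0 * g1 + f1 * g2 + f2 * g3 + f3 * g4 - x ^ 2 * y ^ 2 * f3 * g0)

/-- With `x = A + B` and `y = A - B` one has `x² - y² = 4 A B`; together with the factors `1 / x`
and `1 / y` of the hyperbolic sines this accounts for the denominators of the `k_i`. -/
theorem average_dirCharFun {p lam c α β : ℝ} (h : (α, β) ∈ regularPairs p lam c) (t : ℝ) :
    1 / 4 * ∑ j, dirCharFun p lam c α β j t = explicitCharFun p lam c α β t := by
  have hne := sq_sub_sq_coeff_ne_zero h
  obtain ⟨hA, hB, hs, hd⟩ := h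
  simp only at hA hB hs hd
  obtain ⟨a0, a1, a2, a3⟩ := generator_averages p lam c α β
  have hsum := sq_add_sq_coeff p lam c α β
  simp only [dirCharFun]
  rw [← Finset.mul_sum, Finset.sum_comm]
  simp only [← Finset.mul_sum, Fin.sum_univ_four]
  simp only [Fin.val_zero, Fin.val_one, Fin.val_two, show ((3 : Fin 4) : ℕ) = 3 from rfl,
    a0, a1, a2, a3]
  simp only [explicitCharFun, coeffK0, coeffK1, coeffK2, coeffK3, fundSol, ← add_mul, ← sub_mul,
    neg_mul]
  generalize coeffA p lam c α β = A at *
  generalize coeffB p lam c α β = B at *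
  have hden : (A + B) ^ 2 - (A - B) ^ 2 = 4 * A * B := by ring
  rw [hden]
  field_simp
  ring

end

/-! ### Independence of past and next step, and laws of the steps. -/

noncomputable section

section Independence

variable {Ω : Type*} [MeasurableSpace Ω] {μ : Measure Ω}
variable {p q lam : ℝ} {J₀ : Ω → ZMod 4} {turn : ℕ → Ω → ZMod 4} {τ : ℕ → Ω → ℝ}

/-- The first `n` terms of a sequence, continued by zero. -/
def truncSeq {E : Type*} [Zero E] (n : ℕ) (f : ℕ → E) : ℕ → E := fun k => if k < n then f k else 0

theorem measurable_truncSeq {E : Type*} [Zero E] [MeasurableSpace E] (n : ℕ) :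
    Measurable (truncSeq (E := E) n) := by
  refine measurable_pi_lambda _ fun k => ?_
  unfold truncSeq
  split_ifs <;> fun_prop

/-- Truncation keeps the past in the fixed space of sequences, where the jump functionals are
measurable; their values at step `n` are unaffected by it. -/
theorem indepFun_truncSeq {E : Type*} [Zero E] [MeasurableSpace E] {f : ℕ → Ω → E}
    (hf : iIndepFun f μ) (hm : ∀ n, Measurable (f n)) (n : ℕ) :
    IndepFun (fun ω => truncSeq n fun k => f k ω) (f n) μ := by
  have h := hf.indepFun_finset (Finset.range n) {n} (by simp) hm
  refine h.comp (φ := fun (r : Finset.range n → E) k => if hk : k ∈ Finset.range n then r ⟨k, hk⟩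
    else 0) (ψ := fun r => r ⟨n, Finset.mem_singleton_self n⟩) ?_ (by fun_prop) |>.congr ?_ ?_
  · refine measurable_pi_lambda _ fun k => ?_
    split_ifs <;> fun_prop
  · refine ae_of_all _ fun ω => ?_
    funext k
    simp [truncSeq]
  · exact ae_of_all _ fun ω => rfl

theorem jumpTime_truncSeq (s : ℕ → ℝ) (n : ℕ) : jumpTime (truncSeq n s) n = jumpTime s n :=
  Finset.sum_congr rfl fun k hk => by simp [truncSeq, Finset.mem_range.1 hk]

theorem jumpDir_truncSeq (j : ZMod 4) (u : ℕ → ZMod 4) {k n : ℕ} (hk : k ≤ n) :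
    jumpDir j (truncSeq n u) k = jumpDir j u k := by
  unfold jumpDir
  congr 1
  exact Finset.sum_congr rfl fun i hi => by
    simp [truncSeq, (Finset.mem_range.1 hi).trans_le hk]

theorem jumpPhase_truncSeq (g : ZMod 4 → ℝ) (j : ZMod 4) (u : ℕ → ZMod 4) (s : ℕ → ℝ) (n : ℕ) :
    jumpPhase g j (truncSeq n u) (truncSeq n s) n = jumpPhase g j u s n :=
  Finset.sum_congr rfl fun k hk => by
    rw [jumpDir_truncSeq j u (Finset.mem_range.1 hk).le]
    simp [truncSeq, Finset.mem_range.1 hk]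

theorem measurable_jumpTime {Ω' : Type*} [MeasurableSpace Ω'] {s : ℕ → Ω' → ℝ}
    (hs : ∀ n, Measurable (s n)) (n : ℕ) : Measurable fun ω => jumpTime (fun k => s k ω) n := by
  unfold jumpTime; fun_prop

theorem measurable_jumpDir {Ω' : Type*} [MeasurableSpace Ω'] {j : Ω' → ZMod 4}
    {u : ℕ → Ω' → ZMod 4} (hj : Measurable j) (hu : ∀ n, Measurable (u n)) (n : ℕ) :
    Measurable fun ω => jumpDir (j ω) (fun k => u k ω) n := by
  induction n with
  | zero => simpa only [jumpDir_zero] using hj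
  | succ n ih =>
    simp only [jumpDir_succ]
    exact (measurable_of_countable fun z : ZMod 4 × ZMod 4 => z.1 + z.2).comp (ih.prodMk (hu n))

theorem measurable_jumpPhase {Ω' : Type*} [MeasurableSpace Ω'] (g : ZMod 4 → ℝ)
    {j : Ω' → ZMod 4} {u : ℕ → Ω' → ZMod 4} {s : ℕ → Ω' → ℝ} (hj : Measurable j)
    (hu : ∀ n, Measurable (u n)) (hs : ∀ n, Measurable (s n)) (n : ℕ) :
    Measurable fun ω => jumpPhase g (j ω) (fun k => u k ω) (fun k => s k ω) n := by
  unfold jumpPhase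
  exact Finset.measurable_sum _ fun k _ =>
    ((measurable_of_countable g).comp (measurable_jumpDir hj hu k)).mul (hs k)

theorem expMeasure_real_Ioi {lam x : ℝ} (hlam : 0 < lam) (hx : 0 ≤ x) :
    (expMeasure lam).real (Set.Ioi x) = Real.exp (-(lam * x)) := by
  have := isProbabilityMeasure_expMeasure hlam
  have h := cdf_expMeasure_eq hlam x
  rw [if_pos hx, cdf_eq_real] at h
  rw [← Set.compl_Iic, probReal_compl_eq_one_sub measurableSet_Iic, h]
  ring

theorem ae_expMeasure_pos {lam : ℝ} (hlam : 0 < lam) : ∀ᵐ x ∂(expMeasure lam), 0 < x := by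
  have := isProbabilityMeasure_expMeasure hlam
  refine (mem_ae_iff_prob_eq_one measurableSet_Ioi).2 ?_
  rw [← ENNReal.ofReal_toReal (measure_ne_top _ _)]
  change ENNReal.ofReal ((expMeasure lam).real (Set.Ioi 0)) = 1
  rw [expMeasure_real_Ioi hlam le_rfl]
  simp

theorem IsPlanarMotionData.ae_wait_pos (h : IsPlanarMotionData μ p q lam J₀ turn τ)
    (hlam : 0 < lam) : ∀ᵐ ω ∂μ, ∀ n, 0 < τ n ω := by
  rw [ae_all_iff]
  intro n
  have h1 := ae_expMeasure_pos hlam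
  rw [← h.wait_law n] at h1
  exact ae_of_ae_map (h.measurable_wait n).aemeasurable h1

variable [IsProbabilityMeasure μ]

/-- The joint law of the triple is the product of the three marginals, and the product of measures
is associative. -/
theorem indepFun_assoc {𝓧 𝓨 𝓩 : Type*} [MeasurableSpace 𝓧] [MeasurableSpace 𝓨]
    [MeasurableSpace 𝓩] {X : Ω → 𝓧} {Y : Ω → 𝓨} {Z : Ω → 𝓩} (hX : Measurable X)
    (hY : Measurable Y) (hZ : Measurable Z) (hXY : IndepFun X Y μ)
    (hXYZ : IndepFun (fun ω => (X ω, Y ω)) Z μ) : IndepFun X (fun ω => (Y ω, Z ω)) μ := by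
  have := Measure.isProbabilityMeasure_map (μ := μ) hX.aemeasurable
  have := Measure.isProbabilityMeasure_map (μ := μ) hY.aemeasurable
  have := Measure.isProbabilityMeasure_map (μ := μ) hZ.aemeasurable
  have hYZ : IndepFun Y Z μ := hXYZ.comp measurable_snd measurable_id
  rw [indepFun_iff_map_prod_eq_prod_map_map hX.aemeasurable (hY.prodMk hZ).aemeasurable,
    hYZ.map_prod_eq_prod_map_map hY.aemeasurable hZ.aemeasurable,
    ← (measurePreserving_prodAssoc (μ.map X) (μ.map Y) (μ.map Z)).map_eq,
    ← hXY.map_prod_eq_prod_map_map hX.aemeasurable hY.aemeasurable,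
    ← hXYZ.map_prod_eq_prod_map_map (hX.prodMk hY).aemeasurable hZ.aemeasurable,
    Measure.map_map MeasurableEquiv.prodAssoc.measurable ((hX.prodMk hY).prodMk hZ)]
  rfl

/-- The hypotheses make the four variables mutually independent, so they may be regrouped across the
pairs, here by repeated use of `indepFun_assoc`. -/
theorem indepFun_prodMk_prodMk_of_indepFun {𝓧₁ 𝓧₂ 𝓨₁ 𝓨₂ : Type*} [MeasurableSpace 𝓧₁]
    [MeasurableSpace 𝓧₂] [MeasurableSpace 𝓨₁] [MeasurableSpace 𝓨₂] {X₁ : Ω → 𝓧₁} {X₂ : Ω → 𝓧₂}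
    {Y₁ : Ω → 𝓨₁} {Y₂ : Ω → 𝓨₂} (hX₁ : Measurable X₁) (hX₂ : Measurable X₂)
    (hY₁ : Measurable Y₁) (hY₂ : Measurable Y₂) (hX : IndepFun X₁ X₂ μ) (hY : IndepFun Y₁ Y₂ μ)
    (hXY : IndepFun (fun ω => (X₁ ω, X₂ ω)) (fun ω => (Y₁ ω, Y₂ ω)) μ) :
    IndepFun (fun ω => (X₁ ω, Y₁ ω)) (fun ω => (X₂ ω, Y₂ ω)) μ := by
  have h1 : IndepFun X₂ (fun ω => (X₁ ω, (Y₁ ω, Y₂ ω))) μ :=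
    indepFun_assoc hX₂ hX₁ (hY₁.prodMk hY₂) hX.symm (hXY.comp measurable_swap measurable_id)
  have h2 : IndepFun X₁ (fun ω => (Y₂ ω, Y₁ ω)) μ := hXY.comp measurable_fst measurable_swap
  have h3 : IndepFun Y₂ (fun ω => (Y₁ ω, X₁ ω)) μ :=
    indepFun_assoc hY₂ hY₁ hX₁ hY.symm h2.symm
  have h4 : IndepFun (fun ω => (X₁ ω, Y₁ ω)) Y₂ μ := (h3.comp measurable_id measurable_swap).symm
  have h5 : IndepFun (fun ω => ((X₁ ω, Y₁ ω), Y₂ ω)) X₂ μ :=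
    (h1.comp measurable_id
      (φ := id) (ψ := fun z : 𝓧₁ × 𝓨₁ × 𝓨₂ => ((z.1, z.2.1), z.2.2)) (by fun_prop)).symm
  exact (indepFun_assoc (hX₁.prodMk hY₁) hY₂ hX₂ h4 h5).comp measurable_id measurable_swap

/-- The state of the motion at the `n`-th change of direction is independent of what happens at
the next step. -/
theorem IsPlanarMotionData.indepFun_state_step (h : IsPlanarMotionData μ p q lam J₀ turn τ)
    (g : ZMod 4 → ℝ) (n : ℕ) :
    IndepFun (fun ω => (jumpPhase g (J₀ ω) (fun k => turn k ω) (fun k => τ k ω) n,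
        jumpTime (fun k => τ k ω) n, jumpDir (J₀ ω) (fun k => turn k ω) n))
      (fun ω => (τ n ω, turn n ω)) μ := by
  have hτ : Measurable fun ω k => τ k ω := measurable_pi_lambda _ h.measurable_wait
  have hu : Measurable fun ω k => turn k ω := measurable_pi_lambda _ h.measurable_turn
  have hτn := (measurable_truncSeq (E := ℝ) n).comp hτ
  have hun := (measurable_truncSeq (E := ZMod 4) n).comp hu
  -- Only three variables occur here, so the regrouping lemma is used with a constant in the second
  -- place.
  have hdir : IndepFun (fun ω => (J₀ ω, truncSeq n fun k => turn k ω)) (turn n) μ :=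
    (indepFun_prodMk_prodMk_of_indepFun (X₂ := fun _ : Ω => ()) h.measurable_init
      measurable_const hun (h.measurable_turn n) (indepFun_const_right _ ())
      (indepFun_truncSeq h.indep_turn h.measurable_turn n)
      (h.indep_init_turn.comp (φ := fun a => (a, ())) (ψ := fun u => (truncSeq n u, u n))
        (by fun_prop) ((measurable_truncSeq n).prodMk (measurable_pi_apply n)))).comp
      measurable_id measurable_snd
  have hall := indepFun_prodMk_prodMk_of_indepFun hτn (h.measurable_wait n)
    (h.measurable_init.prodMk hun) (h.measurable_turn n)
    (indepFun_truncSeq h.indep_wait h.measurable_wait n) hdir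
    (h.indep_wait_dir.comp (φ := fun s : ℕ → ℝ => (truncSeq n s, s n))
      (ψ := fun z : ZMod 4 × (ℕ → ZMod 4) => ((z.1, truncSeq n z.2), z.2 n))
      ((measurable_truncSeq n).prodMk (measurable_pi_apply n))
      ((measurable_fst.prodMk ((measurable_truncSeq n).comp measurable_snd)).prodMk
        ((measurable_pi_apply n).comp measurable_snd)))
  have hm : Measurable fun z : (ℕ → ℝ) × (ZMod 4 × (ℕ → ZMod 4)) =>
      (jumpPhase g z.2.1 z.2.2 z.1 n, jumpTime z.1 n, jumpDir z.2.1 z.2.2 n) :=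
    (measurable_jumpPhase g (j := fun z : (ℕ → ℝ) × (ZMod 4 × (ℕ → ZMod 4)) => z.2.1)
      (u := fun k z => z.2.2 k) (s := fun k z => z.1 k)
      (by fun_prop) (by fun_prop) (by fun_prop) n).prodMk
    ((measurable_jumpTime (s := fun k (z : (ℕ → ℝ) × (ZMod 4 × (ℕ → ZMod 4))) => z.1 k)
      (by fun_prop) n).prodMk
      (measurable_jumpDir (j := fun z : (ℕ → ℝ) × (ZMod 4 × (ℕ → ZMod 4)) => z.2.1)
        (u := fun k z => z.2.2 k) (by fun_prop) (by fun_prop) n))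
  refine (hall.comp hm measurable_id).congr (ae_of_all _ fun ω => ?_) (ae_of_all _ fun ω => rfl)
  simp only [Function.comp, jumpPhase_truncSeq, jumpTime_truncSeq, jumpDir_truncSeq _ _ le_rfl]

/-- By the second Borel–Cantelli lemma infinitely many waiting times exceed `1`: these events are
independent, each of probability `exp (-lam)`. -/
theorem IsPlanarMotionData.ae_tendsto_jumpTime (h : IsPlanarMotionData μ p q lam J₀ turn τ)
    (hlam : 0 < lam) : ∀ᵐ ω ∂μ, Tendsto (jumpTime fun k => τ k ω) atTop atTop := by
  have := isProbabilityMeasure_expMeasure hlam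
  have hms : ∀ n, MeasurableSet (τ n ⁻¹' Set.Ioi 1) := fun n =>
    h.measurable_wait n measurableSet_Ioi
  have hind : iIndepSet (fun n => τ n ⁻¹' Set.Ioi 1) μ := by
    rw [iIndepSet_iff_meas_biInter hms]
    intro S
    exact h.indep_wait.measure_inter_preimage_eq_mul S fun _ _ => measurableSet_Ioi
  have hprob : ∀ n, μ (τ n ⁻¹' Set.Ioi 1) = ENNReal.ofReal (Real.exp (-(lam * 1))) := by
    intro n
    rw [← Measure.map_apply (h.measurable_wait n) measurableSet_Ioi, h.wait_law n,
      ← expMeasure_real_Ioi hlam zero_le_one, ofReal_measureReal]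
  have hlimsup := measure_limsup_eq_one hms hind (by
    simp only [hprob]
    exact ENNReal.tsum_const_eq_top_of_ne_zero (by simp [Real.exp_pos]))
  have hae : ∀ᵐ ω ∂μ, ω ∈ limsup (fun n => τ n ⁻¹' Set.Ioi 1) atTop :=
    (mem_ae_iff_prob_eq_one (MeasurableSet.measurableSet_limsup hms)).2 hlimsup
  filter_upwards [hae, h.ae_wait_pos hlam] with ω hω hpos
  rw [mem_limsup_iff_frequently_mem] at hω
  have hmono := jumpTime_mono (s := fun k => τ k ω) fun n => (hpos n).le
  refine tendsto_atTop_atTop_of_monotone hmono fun b => ?_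
  have hnat : ∀ m : ℕ, ∃ n, (m : ℝ) ≤ jumpTime (fun k => τ k ω) n := by
    intro m
    induction m with
    | zero => exact ⟨0, by simp [jumpTime_zero]⟩
    | succ m ih =>
      obtain ⟨n, hn⟩ := ih
      obtain ⟨k, hk, hk1⟩ := (frequently_atTop.1 hω) n
      refine ⟨k + 1, ?_⟩
      rw [jumpTime_succ]
      have h1 : 1 < τ k ω := hk1
      push_cast
      linarith [hmono hk]
  obtain ⟨m, hm⟩ := exists_nat_ge b
  obtain ⟨n, hn⟩ := hnat m
  exact ⟨n, hm.trans hn⟩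

theorem integral_expMeasure {lam : ℝ} (hlam : 0 < lam) (f : ℝ → ℂ) :
    ∫ s, f s ∂(expMeasure lam)
      = ∫ s in Set.Ioi (0 : ℝ), ((lam * Real.exp (-(lam * s)) : ℝ) : ℂ) * f s := by
  have hd : expMeasure lam = volume.withDensity (exponentialPDF lam) := rfl
  rw [hd, integral_withDensity_eq_integral_toReal_smul (g := f)
    (show Measurable (exponentialPDF lam) from
      (measurable_exponentialPDFReal lam).ennreal_ofReal)
    (ae_of_all _ fun _ => ENNReal.ofReal_lt_top),
    ← integral_Ici_eq_integral_Ioi, ← integral_indicator measurableSet_Ici]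
  refine integral_congr_ae (ae_of_all _ fun s => ?_)
  by_cases hs : 0 ≤ s
  · simp only [Set.indicator, Set.mem_Ici, hs, if_true]
    rw [exponentialPDF_of_nonneg hs, ENNReal.toReal_ofReal (by positivity), Complex.real_smul]
  · simp only [Set.indicator, Set.mem_Ici, hs, if_false]
    rw [exponentialPDF_of_neg (not_le.1 hs)]
    simp

/-- The condition `p + q = 1` removes the mass of reflections, and total mass `1` then leaves none
for the turn `0`. -/
theorem IsPlanarMotionData.integral_turn (h : IsPlanarMotionData μ p q lam J₀ turn τ)
    (hpq : p + q = 1) (n : ℕ) (g : ZMod 4 → ℂ) :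
    ∫ k, g k ∂(μ.map (turn n)) = p * g 1 + q * g (-1) := by
  have hm := h.measurable_turn n
  have := Measure.isProbabilityMeasure_map (μ := μ) hm.aemeasurable
  have hreal : ∀ k, (μ.map (turn n)).real {k} = μ.real {ω | turn n ω = k} := fun k => by
    rw [map_measureReal_apply hm (measurableSet_singleton k)]; rfl
  have h1 := (hreal 1).trans (h.turn_ccw n)
  have h2 := (hreal (-1)).trans (h.turn_cw n)
  have h3 := (hreal 2).trans (h.turn_refl n)
  have htot : ∑ k, (μ.map (turn n)).real {k} = 1 := by
    rw [sum_measureReal_singleton]; simp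
  have e : ((-1 : ZMod 4)) = 3 := rfl
  rw [e] at h2 ⊢
  have htot' : (μ.map (turn n)).real {0} + (μ.map (turn n)).real {1} + (μ.map (turn n)).real {2}
      + (μ.map (turn n)).real {3} = 1 := by
    rw [← htot]; exact (Fin.sum_univ_four (fun k : ZMod 4 => (μ.map (turn n)).real {k})).symm
  have h0 : (μ.map (turn n)).real {0} = 0 := by linarith
  have h2' : (μ.map (turn n)).real {2} = 0 := by linarith
  rw [integral_fintype (.of_finite), sum_zmod_four]
  simp [h0, h1, h2, h2']

theorem IsPlanarMotionData.integral_init (h : IsPlanarMotionData μ p q lam J₀ turn τ)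
    (g : ZMod 4 → ℂ) : ∫ ω, g (J₀ ω) ∂μ = 1 / 4 * ∑ j, g j := by
  have hm := h.measurable_init
  have := Measure.isProbabilityMeasure_map (μ := μ) hm.aemeasurable
  have hreal : ∀ k, (μ.map J₀).real {k} = 1 / 4 := fun k => by
    rw [map_measureReal_apply hm (measurableSet_singleton k)]; exact h.init_law k
  rw [← integral_map hm.aemeasurable (measurable_of_countable g).aestronglyMeasurable,
    integral_fintype (.of_finite), Finset.mul_sum]
  simp [hreal]

end Independence

end

/-! ### From the backward equations to the characteristic function. -/

noncomputable section

/-- The backward equations for the conditional expectations `U j t` of `exp (i Θ(t))` given the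
initial direction `j`, where `Θ` grows at rate `v j` while the direction is `j`. -/
structure IsBackwardSolution (p q lam : ℝ) (v : ZMod 4 → ℝ) (U : ZMod 4 → ℝ → ℂ) : Prop where
  init : ∀ j, U j 0 = 1
  deriv : ∀ j r, HasDerivAt (U j)
    ((Complex.I * v j - lam) * U j r + lam * (p * U (j + 1) r + q * U (j - 1) r)) r

/-- The contribution of a path whose current state is `(V, T, d)`: accumulated phase, time of the
last change of direction, and direction. -/
def stateValue (U : ZMod 4 → ℝ → ℂ) (t : ℝ) (x : ℝ × ℝ × ZMod 4) : ℂ :=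
  if x.2.1 ≤ t then Complex.exp (Complex.I * x.1) * U x.2.2 (t - x.2.1) else 0

/-- The contribution of a path in state `(V, T, d)` that has not changed direction again at time
`t`, the next change of direction being at time `T + s`. -/
def flightValue (v : ZMod 4 → ℝ) (t : ℝ) (x : ℝ × ℝ × ZMod 4) (s : ℝ) : ℂ :=
  if x.2.1 ≤ t ∧ t < x.2.1 + s then
    Complex.exp (Complex.I * ((x.1 + v x.2.2 * (t - x.2.1) : ℝ) : ℂ)) else 0

/-- The state after the next change of direction. -/
def nextState (v : ZMod 4 → ℝ) (x : ℝ × ℝ × ZMod 4) (y : ℝ × ZMod 4) : ℝ × ℝ × ZMod 4 :=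
  (x.1 + v x.2.2 * y.1, x.2.1 + y.1, x.2.2 + y.2)

variable {p q lam : ℝ} {v : ZMod 4 → ℝ} {U : ZMod 4 → ℝ → ℂ}

theorem IsBackwardSolution.continuous (hU : IsBackwardSolution p q lam v U) (j : ZMod 4) :
    Continuous (U j) :=
  continuous_iff_continuousAt.2 fun r => (hU.deriv j r).continuousAt

theorem IsBackwardSolution.exists_bound (hU : IsBackwardSolution p q lam v U) (t : ℝ) :
    ∃ K : ℝ, 0 ≤ K ∧ ∀ j, ∀ r ∈ Set.Icc 0 t, ‖U j r‖ ≤ K := by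
  have h : ∀ j, ∃ C, ∀ r ∈ Set.Icc 0 t, ‖U j r‖ ≤ C := fun j =>
    isCompact_Icc.exists_bound_of_continuousOn (hU.continuous j).continuousOn
  choose C hC using h
  refine ⟨∑ j, |C j|, Finset.sum_nonneg fun j _ => abs_nonneg _, fun j r hr => ?_⟩
  exact (hC j r hr).trans ((le_abs_self _).trans
    (Finset.single_le_sum (f := fun j => |C j|) (fun j _ => abs_nonneg _) (Finset.mem_univ j)))

theorem measurable_stateValue (hU : ∀ j, Continuous (U j)) (t : ℝ) :
    Measurable (stateValue U t) := by
  have hU' : Measurable fun z : ZMod 4 × ℝ => U z.1 z.2 :=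
    measurable_from_prod_countable_right fun j => (hU j).measurable
  refine Measurable.ite (measurableSet_le (by fun_prop) measurable_const) ?_ measurable_const
  refine Measurable.mul (by fun_prop) ?_
  exact hU'.comp (f := fun x : ℝ × ℝ × ZMod 4 => (x.2.2, t - x.2.1)) (by fun_prop)

theorem measurable_flightValue (v : ZMod 4 → ℝ) (t : ℝ) :
    Measurable fun z : (ℝ × ℝ × ZMod 4) × ℝ => flightValue v t z.1 z.2 := by
  have hv : Measurable v := measurable_of_countable v
  have h1 : MeasurableSet {z : (ℝ × ℝ × ZMod 4) × ℝ | z.1.2.1 ≤ t} :=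
    measurableSet_le (by fun_prop) measurable_const
  have h2 : MeasurableSet {z : (ℝ × ℝ × ZMod 4) × ℝ | t < z.1.2.1 + z.2} :=
    measurableSet_lt measurable_const (by fun_prop)
  refine Measurable.ite (h1.inter h2) ?_ measurable_const
  fun_prop

theorem measurable_nextState (v : ZMod 4 → ℝ) :
    Measurable fun z : (ℝ × ℝ × ZMod 4) × (ℝ × ZMod 4) => nextState v z.1 z.2 := by
  have hv : Measurable v := measurable_of_countable v
  have hadd : Measurable fun z : ZMod 4 × ZMod 4 => z.1 + z.2 := measurable_of_countable _
  refine Measurable.prodMk (by fun_prop) (Measurable.prodMk (by fun_prop) ?_)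
  exact hadd.comp (f := fun z : (ℝ × ℝ × ZMod 4) × (ℝ × ZMod 4) => (z.1.2.2, z.2.2)) (by fun_prop)

theorem norm_flightValue_le (v : ZMod 4 → ℝ) (t : ℝ) (x : ℝ × ℝ × ZMod 4) (s : ℝ) :
    ‖flightValue v t x s‖ ≤ 1 := by
  unfold flightValue
  split_ifs
  · rw [mul_comm, Complex.norm_exp_ofReal_mul_I]
  · simp

theorem norm_stateValue_le {K t : ℝ} (hK : 0 ≤ K) (hUK : ∀ j, ∀ r ∈ Set.Icc 0 t, ‖U j r‖ ≤ K)
    {x : ℝ × ℝ × ZMod 4} (hx : 0 ≤ x.2.1) : ‖stateValue U t x‖ ≤ K := by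
  unfold stateValue
  split_ifs with h
  · rw [norm_mul, mul_comm Complex.I, Complex.norm_exp_ofReal_mul_I, one_mul]
    exact hUK _ _ ⟨by linarith, by linarith⟩
  · simpa using hK

/-- Duhamel's formula: the expected value after one step is the value before it. -/
theorem IsBackwardSolution.integral_step (hU : IsBackwardSolution p q lam v U) (hlam : 0 < lam)
    (d : ZMod 4) {r : ℝ} (hr : 0 ≤ r) :
    Integrable (fun s : ℝ => if r < s then Complex.exp (Complex.I * v d * r) else
      Complex.exp (Complex.I * v d * s) * (p * U (d + 1) (r - s) + q * U (d - 1) (r - s)))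
      (expMeasure lam) ∧
    ∫ s, (if r < s then Complex.exp (Complex.I * v d * r) else
      Complex.exp (Complex.I * v d * s) * (p * U (d + 1) (r - s) + q * U (d - 1) (r - s)))
      ∂(expMeasure lam) = U d r := by
  have := isProbabilityMeasure_expMeasure hlam
  have hc1 := hU.continuous (d + 1)
  have hc2 := hU.continuous (d - 1)
  set ψ : ℝ → ℂ := fun s =>
    Complex.exp (Complex.I * v d * s) * (p * U (d + 1) (r - s) + q * U (d - 1) (r - s)) with hψ
  have hψc : Continuous ψ := by fun_prop
  obtain ⟨C, hC⟩ := isCompact_Icc.exists_bound_of_continuousOn (s := Set.Icc 0 r) hψc.continuousOn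
  have hint : Integrable (fun s : ℝ => if r < s then Complex.exp (Complex.I * v d * r) else ψ s)
      (expMeasure lam) := by
    refine Integrable.of_bound (Measurable.aestronglyMeasurable
      (Measurable.ite measurableSet_Ioi measurable_const hψc.measurable))
      (max ‖Complex.exp (Complex.I * v d * r)‖ C) ?_
    filter_upwards [ae_expMeasure_pos hlam] with s hs
    split_ifs with h
    · exact le_max_left _ _
    · exact (hC s ⟨hs.le, not_lt.1 h⟩).trans (le_max_right _ _)
  refine ⟨hint, ?_⟩
  have h1 : ∫ s in Set.Ioi r, (if r < s then Complex.exp (Complex.I * v d * r) else ψ s)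
      ∂(expMeasure lam) = Complex.exp ((Complex.I * v d - lam) * r) := by
    rw [setIntegral_congr_fun measurableSet_Ioi (g := fun _ => Complex.exp (Complex.I * v d * r))
      (fun s (hs : r < s) => if_pos hs), setIntegral_const, expMeasure_real_Ioi hlam hr,
      Complex.real_smul,
      Complex.ofReal_exp, ← Complex.exp_add]
    congr 1
    push_cast
    ring
  have h2 : ∫ s in Set.Iic r, (if r < s then Complex.exp (Complex.I * v d * r) else ψ s)
      ∂(expMeasure lam) = U d r - Complex.exp ((Complex.I * v d - lam) * r) := by
    rw [setIntegral_congr_fun measurableSet_Iic (g := ψ)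
      (fun s (hs : s ≤ r) => if_neg (not_lt.2 hs)),
      ← integral_indicator measurableSet_Iic, integral_expMeasure hlam]
    have h3 : ∀ s : ℝ, ((lam * Real.exp (-(lam * s)) : ℝ) : ℂ) * (Set.Iic r).indicator ψ s
        = (Set.Iic r).indicator
          (fun s : ℝ => ((lam * Real.exp (-(lam * s)) : ℝ) : ℂ) * ψ s) s := fun s => by
      by_cases hs : s ∈ Set.Iic r <;> simp [hs]
    simp only [h3]
    rw [setIntegral_indicator measurableSet_Iic, Set.Ioi_inter_Iic,
      ← intervalIntegral.integral_of_le hr]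
    -- In the derivative of this product the terms containing `U d` cancel by the backward equation,
    -- leaving exactly the integrand; the boundary terms give `U d r` minus the contribution of no
    -- change before `r`.
    have hder : ∀ s ∈ Set.uIcc 0 r, HasDerivAt
        (fun s : ℝ => -(Complex.exp ((Complex.I * v d - lam) * s) * U d (r - s)))
        (((lam * Real.exp (-(lam * s)) : ℝ) : ℂ) * ψ s) s := by
      intro s _
      have he : HasDerivAt (fun s : ℝ => Complex.exp ((Complex.I * v d - lam) * s))
          ((Complex.I * v d - lam) * Complex.exp ((Complex.I * v d - lam) * s)) s := by
        have := ((hasDerivAt_id (s : ℂ)).const_mul (Complex.I * v d - lam : ℂ)).cexp.comp_ofReal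
        simpa [mul_comm] using this
      have hu : HasDerivAt (fun s : ℝ => U d (r - s)) _ s :=
        (hU.deriv d (r - s)).scomp s ((hasDerivAt_id s).const_sub r)
      refine ((he.mul hu).neg).congr_deriv ?_
      have hexp : Complex.exp ((Complex.I * v d - lam) * s)
          = Complex.exp (-(lam * s)) * Complex.exp (Complex.I * v d * s) := by
        rw [← Complex.exp_add]; congr 1; ring
      rw [hψ, hexp]
      push_cast
      simp only [neg_smul, one_smul]
      ring
    rw [intervalIntegral.integral_eq_sub_of_hasDerivAt hder
      (Continuous.intervalIntegrable (by fun_prop) _ _)]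
    simp [hU.init]
    ring
  rw [← integral_add_compl measurableSet_Ioi hint, Set.compl_Ioi, h1, h2]
  ring

section Probability

variable {Ω : Type*} {J₀ : Ω → ZMod 4} {turn : ℕ → Ω → ZMod 4} {τ : ℕ → Ω → ℝ}

/-- The state of the motion at the `n`-th change of direction. -/
def motionState (v : ZMod 4 → ℝ) (J₀ : Ω → ZMod 4) (turn : ℕ → Ω → ZMod 4) (τ : ℕ → Ω → ℝ)
    (n : ℕ) (ω : Ω) : ℝ × ℝ × ZMod 4 :=
  (jumpPhase v (J₀ ω) (fun k => turn k ω) (fun k => τ k ω) n,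
    jumpTime (fun k => τ k ω) n, jumpDir (J₀ ω) (fun k => turn k ω) n)

theorem motionState_succ (v : ZMod 4 → ℝ) (J₀ : Ω → ZMod 4) (turn : ℕ → Ω → ZMod 4)
    (τ : ℕ → Ω → ℝ) (n : ℕ) (ω : Ω) : motionState v J₀ turn τ (n + 1) ω
      = nextState v (motionState v J₀ turn τ n ω) (τ n ω, turn n ω) := by
  simp only [motionState, nextState, jumpPhase_succ, jumpTime_succ, jumpDir_succ]

/-- Along a typical path the partial sums are eventually equal to `exp (i Θ(t))`. -/
theorem partial_of_path {c α β t : ℝ} {ω : Ω} {K : ℝ} (hK : 0 ≤ K)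
    (hUK : ∀ j, ∀ r ∈ Set.Icc 0 t, ‖U j r‖ ≤ K)
    (hpos : ∀ n, 0 < τ n ω) (hlim : Tendsto (jumpTime fun k => τ k ω) atTop atTop) (ht : 0 ≤ t) :
    (∀ n, ‖(∑ m ∈ Finset.range n, flightValue (projVelocity c α β) t
        (motionState (projVelocity c α β) J₀ turn τ m ω) (τ m ω))
      + stateValue U t (motionState (projVelocity c α β) J₀ turn τ n ω)‖ ≤ 1 + K) ∧
    ∀ᶠ n in atTop, (∑ m ∈ Finset.range n, flightValue (projVelocity c α β) t
        (motionState (projVelocity c α β) J₀ turn τ m ω) (τ m ω))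
      + stateValue U t (motionState (projVelocity c α β) J₀ turn τ n ω)
      = Complex.exp (Complex.I *
        ((α * posX c J₀ turn τ t ω + β * posY c J₀ turn τ t ω : ℝ) : ℂ)) := by
  have hs : ∀ n, 0 ≤ τ n ω := fun n => (hpos n).le
  have hmono := jumpTime_mono (s := fun k => τ k ω) hs
  obtain ⟨N, h1, h2⟩ := exists_jumpTime_le_lt hlim ht
  -- Only the flight during which time `t` falls contributes, so the bound `1 + K` does not depend
  -- on `n`.
  have hzero : ∀ m, m ≠ N → flightValue (projVelocity c α β) t
      (motionState (projVelocity c α β) J₀ turn τ m ω) (τ m ω) = 0 := by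
    intro m hm
    refine if_neg ?_
    simp only [motionState]
    rw [← jumpTime_succ (fun k => τ k ω) m]
    rintro ⟨ha, hb⟩
    rcases lt_or_gt_of_ne hm with hlt | hgt
    · linarith [hmono (Nat.succ_le_of_lt hlt)]
    · linarith [hmono (Nat.succ_le_of_lt hgt)]
  constructor
  · intro n
    refine (norm_add_le _ _).trans (add_le_add ?_
      (norm_stateValue_le hK hUK (jumpTime_nonneg hs n)))
    by_cases hn : N ∈ Finset.range n
    · rw [Finset.sum_eq_single N (fun m _ hm => hzero m hm) (fun hc => absurd hn hc)]
      exact norm_flightValue_le _ _ _ _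
    · rw [Finset.sum_eq_zero fun m hm => hzero m fun hmN => hn (hmN ▸ hm)]
      simp
  · filter_upwards [eventually_gt_atTop N] with n hn
    have hT : ¬ jumpTime (fun k => τ k ω) n ≤ t :=
      not_le.2 (h2.trans_le (hmono (Nat.succ_le_of_lt hn)))
    rw [Finset.sum_eq_single N (fun m _ hm => hzero m hm)
      (fun hc => absurd (Finset.mem_range.2 hn) hc), proj_pos_eq c α β J₀ turn hs h1 h2]
    have h2' : t < jumpTime (fun k => τ k ω) N + τ N ω := by rwa [← jumpTime_succ]
    simp [flightValue, stateValue, motionState, hT, h1, h2']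

variable [MeasurableSpace Ω] {μ : Measure Ω}

theorem IsPlanarMotionData.measurable_motionState (h : IsPlanarMotionData μ p q lam J₀ turn τ)
    (v : ZMod 4 → ℝ) (n : ℕ) : Measurable (motionState v J₀ turn τ n) :=
  (measurable_jumpPhase v h.measurable_init h.measurable_turn h.measurable_wait n).prodMk
    ((measurable_jumpTime h.measurable_wait n).prodMk
      (measurable_jumpDir h.measurable_init h.measurable_turn n))

variable [IsProbabilityMeasure μ]

theorem IsPlanarMotionData.integrable_stateValue (h : IsPlanarMotionData μ p q lam J₀ turn τ)
    (hlam : 0 < lam) (hU : IsBackwardSolution p q lam v U) (t : ℝ) (n : ℕ) :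
    Integrable (fun ω => stateValue U t (motionState v J₀ turn τ n ω)) μ := by
  obtain ⟨K, hK, hUK⟩ := hU.exists_bound t
  refine Integrable.of_bound ((measurable_stateValue hU.continuous t).comp
    (h.measurable_motionState v n)).aestronglyMeasurable K ?_
  filter_upwards [h.ae_wait_pos hlam] with ω hω
  exact norm_stateValue_le hK hUK (jumpTime_nonneg (fun k => (hω k).le) n)

theorem IsPlanarMotionData.integrable_flightValue (h : IsPlanarMotionData μ p q lam J₀ turn τ)
    (v : ZMod 4 → ℝ) (t : ℝ) (n : ℕ) :
    Integrable (fun ω => flightValue v t (motionState v J₀ turn τ n ω) (τ n ω)) μ :=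
  Integrable.of_bound ((measurable_flightValue v t).comp
    ((h.measurable_motionState v n).prodMk (h.measurable_wait n))).aestronglyMeasurable 1
    (ae_of_all _ fun _ => norm_flightValue_le _ _ _ _)

/-- The change of value in one step has expectation zero. -/
theorem IsPlanarMotionData.integral_step (h : IsPlanarMotionData μ p q lam J₀ turn τ)
    (hlam : 0 < lam) (hpq : p + q = 1) (hU : IsBackwardSolution p q lam v U) (t : ℝ) (n : ℕ) :
    ∫ ω, (flightValue v t (motionState v J₀ turn τ n ω) (τ n ω)
      + stateValue U t (motionState v J₀ turn τ (n + 1) ω)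
      - stateValue U t (motionState v J₀ turn τ n ω)) ∂μ = 0 := by
  have hexp := isProbabilityMeasure_expMeasure hlam
  set H : (ℝ × ℝ × ZMod 4) × (ℝ × ZMod 4) → ℂ := fun z =>
    flightValue v t z.1 z.2.1 + stateValue U t (nextState v z.1 z.2) - stateValue U t z.1 with hH
  have hHm : Measurable H :=
    (((measurable_flightValue v t).comp (f := fun z : (ℝ × ℝ × ZMod 4) × (ℝ × ZMod 4) =>
      (z.1, z.2.1)) (by fun_prop)).add
      ((measurable_stateValue hU.continuous t).comp (measurable_nextState v))).sub
      ((measurable_stateValue hU.continuous t).comp measurable_fst)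
  have hX := h.measurable_motionState v n
  have hY : Measurable fun ω => (τ n ω, turn n ω) :=
    (h.measurable_wait n).prodMk (h.measurable_turn n)
  have hXY : IndepFun (motionState v J₀ turn τ n) (fun ω => (τ n ω, turn n ω)) μ :=
    h.indepFun_state_step v n
  have hstep : IndepFun (τ n) (turn n) μ :=
    h.indep_wait_dir.comp (φ := fun s : ℕ → ℝ => s n)
      (ψ := fun z : ZMod 4 × (ℕ → ZMod 4) => z.2 n) (by fun_prop) (by fun_prop)
  have hlawY : μ.map (fun ω => (τ n ω, turn n ω)) = (expMeasure lam).prod (μ.map (turn n)) := by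
    rw [hstep.map_prod_eq_prod_map_map (h.measurable_wait n).aemeasurable
      (h.measurable_turn n).aemeasurable, h.wait_law n]
  have hlaw := hXY.map_prod_eq_prod_map_map hX.aemeasurable hY.aemeasurable
  rw [hlawY] at hlaw
  have := Measure.isProbabilityMeasure_map (μ := μ) hX.aemeasurable
  have := Measure.isProbabilityMeasure_map (μ := μ) (h.measurable_turn n).aemeasurable
  have hHi : Integrable H ((μ.map (motionState v J₀ turn τ n)).prod
      ((expMeasure lam).prod (μ.map (turn n)))) := by
    rw [← hlaw, integrable_map_measure hHm.aestronglyMeasurable (hX.prodMk hY).aemeasurable]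
    have := ((h.integrable_flightValue v t n).add (h.integrable_stateValue hlam hU t (n + 1))).sub
      (h.integrable_stateValue hlam hU t n)
    refine this.congr (ae_of_all _ fun ω => ?_)
    simp [hH, Function.comp, motionState_succ]
  have hcomp : ∫ ω, (flightValue v t (motionState v J₀ turn τ n ω) (τ n ω)
      + stateValue U t (motionState v J₀ turn τ (n + 1) ω)
      - stateValue U t (motionState v J₀ turn τ n ω)) ∂μ
      = ∫ ω, H (motionState v J₀ turn τ n ω, (τ n ω, turn n ω)) ∂μ := by
    simp only [hH, motionState_succ]
  -- The law of (state, step) is a product, so the state can be frozen and the inner integral over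
  -- waiting time and turn shown to vanish.
  rw [hcomp, ← integral_map (φ := fun ω => (motionState v J₀ turn τ n ω, (τ n ω, turn n ω)))
    (hX.prodMk hY).aemeasurable hHm.aestronglyMeasurable, hlaw, integral_prod _ hHi]
  refine integral_eq_zero_of_ae ?_
  filter_upwards [hHi.prod_right_ae] with x hx
  rw [integral_prod _ hx]
  simp only [h.integral_turn hpq n]
  obtain ⟨V, T, d⟩ := x
  simp only [hH, Pi.zero_apply]
  by_cases hT : T ≤ t
  · obtain ⟨hi, he⟩ := hU.integral_step hlam d (sub_nonneg.2 hT)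
    have hpqc : (p : ℂ) + q = 1 := by exact_mod_cast hpq
    -- For `T ≤ t` the phase `exp (i V)` factors out and Duhamel's formula applies with remaining
    -- time `t - T`.
    have hval : ∫ s, Complex.exp (Complex.I * V) * ((if t - T < s then
        Complex.exp (Complex.I * v d * (t - T : ℝ)) else
        Complex.exp (Complex.I * v d * s) * (p * U (d + 1) (t - T - s) + q * U (d - 1) (t - T - s)))
        - U d (t - T)) ∂(expMeasure lam) = 0 := by
      rw [integral_const_mul, integral_sub hi (integrable_const _), he]
      simp
    rw [← hval]
    refine integral_congr_ae ?_
    filter_upwards with s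
    have e1 : t - (T + s) = t - T - s := by ring
    have e2 : d + -1 = d - 1 := (sub_eq_add_neg d 1).symm
    by_cases hs : t - T < s
    · have hs1 : t < T + s := by linarith
      simp only [flightValue, stateValue, nextState, hT, hs1, and_self, if_true, hs, not_le.2 hs1,
        if_false, add_zero]
      have e3 : Complex.exp (Complex.I * ((V + v d * (t - T) : ℝ) : ℂ))
          = Complex.exp (Complex.I * V) * Complex.exp (Complex.I * v d * (t - T : ℝ)) := by
        rw [← Complex.exp_add]; congr 1; push_cast; ring
      rw [e3]
      linear_combination (Complex.exp (Complex.I * V) * Complex.exp (Complex.I * v d * (t - T : ℝ))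
        - Complex.exp (Complex.I * V) * U d (t - T)) * hpqc
    · have hs1 : T + s ≤ t := by linarith
      simp only [flightValue, stateValue, nextState, hT, hs1, not_lt.2 hs1, and_false, if_true, hs,
        if_false, zero_add, e1, e2]
      have e3 : Complex.exp (Complex.I * ((V + v d * s : ℝ) : ℂ))
          = Complex.exp (Complex.I * V) * Complex.exp (Complex.I * v d * s) := by
        rw [← Complex.exp_add]; congr 1; push_cast; ring
      rw [e3]
      linear_combination - Complex.exp (Complex.I * V) * U d (t - T) * hpqc
  -- For `T > t` all three terms vanish, since the next waiting time is almost surely positive.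
  · refine integral_eq_zero_of_ae ?_
    filter_upwards [ae_expMeasure_pos hlam] with s hs
    have hs1 : ¬ T + s ≤ t := by linarith [not_le.1 hT]
    simp [flightValue, stateValue, nextState, hT, hs1]

theorem IsPlanarMotionData.integral_partial (h : IsPlanarMotionData μ p q lam J₀ turn τ)
    (hlam : 0 < lam) (hpq : p + q = 1) (hU : IsBackwardSolution p q lam v U) {t : ℝ} (ht : 0 ≤ t)
    (n : ℕ) :
    ∫ ω, ((∑ m ∈ Finset.range n, flightValue v t (motionState v J₀ turn τ m ω) (τ m ω))
      + stateValue U t (motionState v J₀ turn τ n ω)) ∂μ = 1 / 4 * ∑ j, U j t := by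
  induction n with
  | zero =>
    rw [← h.integral_init fun j => U j t]
    simp [motionState, stateValue, jumpTime_zero, jumpPhase_zero, jumpDir_zero, ht]
  | succ n ih =>
    have hi1 : Integrable (fun ω =>
        (∑ m ∈ Finset.range n, flightValue v t (motionState v J₀ turn τ m ω) (τ m ω))
        + stateValue U t (motionState v J₀ turn τ n ω)) μ :=
      (integrable_finsetSum _ fun m _ => h.integrable_flightValue v t m).add
        (h.integrable_stateValue hlam hU t n)
    have hi2 : Integrable (fun ω => flightValue v t (motionState v J₀ turn τ n ω) (τ n ω)
        + stateValue U t (motionState v J₀ turn τ (n + 1) ω)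
        - stateValue U t (motionState v J₀ turn τ n ω)) μ :=
      ((h.integrable_flightValue v t n).add
        (h.integrable_stateValue hlam hU t (n + 1))).sub (h.integrable_stateValue hlam hU t n)
    have hadd := integral_add hi1 hi2
    rw [h.integral_step hlam hpq hU t n, add_zero, ih] at hadd
    rw [← hadd]
    refine integral_congr_ae (ae_of_all _ fun ω => ?_)
    simp only [Finset.sum_range_succ]
    ring

/-- The partial sums have constant mean, are bounded by `1 + K` and converge almost surely. The same
convergence supplies the measurability of the exponential of the path integrals. -/
theorem IsPlanarMotionData.motionCharFun_eq {c α β : ℝ}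
    (h : IsPlanarMotionData μ p q lam J₀ turn τ) (hlam : 0 < lam) (hpq : p + q = 1)
    (hU : IsBackwardSolution p q lam (projVelocity c α β) U) {t : ℝ} (ht : 0 ≤ t) :
    AEStronglyMeasurable (fun ω => Complex.exp (Complex.I *
        ((α * posX c J₀ turn τ t ω + β * posY c J₀ turn τ t ω : ℝ) : ℂ))) μ ∧
      motionCharFun μ c J₀ turn τ α β t = 1 / 4 * ∑ j, U j t := by
  obtain ⟨K, hK, hUK⟩ := hU.exists_bound t
  have hmeas : ∀ n, AEStronglyMeasurable (fun ω =>
      (∑ m ∈ Finset.range n, flightValue (projVelocity c α β) t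
        (motionState (projVelocity c α β) J₀ turn τ m ω) (τ m ω))
      + stateValue U t (motionState (projVelocity c α β) J₀ turn τ n ω)) μ := fun n =>
    ((integrable_finsetSum _ fun m _ => h.integrable_flightValue _ t m).add
      (h.integrable_stateValue hlam hU t n)).aestronglyMeasurable
  have hpath := (h.ae_wait_pos hlam).and (h.ae_tendsto_jumpTime hlam)
  have hlim : ∀ᵐ ω ∂μ, Tendsto (fun n =>
      (∑ m ∈ Finset.range n, flightValue (projVelocity c α β) t
        (motionState (projVelocity c α β) J₀ turn τ m ω) (τ m ω))
      + stateValue U t (motionState (projVelocity c α β) J₀ turn τ n ω)) atTop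
      (𝓝 (Complex.exp (Complex.I *
        ((α * posX c J₀ turn τ t ω + β * posY c J₀ turn τ t ω : ℝ) : ℂ)))) := by
    filter_upwards [hpath] with ω hω
    exact tendsto_const_nhds.congr' (EventuallyEq.symm
      (partial_of_path hK hUK hω.1 hω.2 ht).2)
  refine ⟨aestronglyMeasurable_of_tendsto_ae atTop hmeas hlim, ?_⟩
  have hdct := tendsto_integral_of_dominated_convergence (fun _ => 1 + K) hmeas
    (integrable_const _) (fun n => by
      filter_upwards [hpath] with ω hω
      exact (partial_of_path hK hUK hω.1 hω.2 ht).1 n) hlim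
  simp only [h.integral_partial hlam hpq hU ht] at hdct
  exact tendsto_nhds_unique hdct tendsto_const_nhds

end Probability

end

/-! ### Density of the regular pairs and passage to the limit. -/

/-- The first expression is `(A + B)² (A - B)²` and the second is the discriminant `((A + B)² - (A -
B)²)² = 16 A² B²`. -/
theorem mem_regularPairs_of_ne {p lam c α β : ℝ}
    (h1 : c ^ 4 * α ^ 2 * β ^ 2 - lam ^ 4 * (2 * p - 1) ^ 2 ≠ 0)
    (h2 : (4 * lam ^ 2 * p * (1 - p) - c ^ 2 * (α ^ 2 + β ^ 2)) ^ 2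
      - 4 * (c ^ 4 * α ^ 2 * β ^ 2 - lam ^ 4 * (2 * p - 1) ^ 2) ≠ 0) :
    (α, β) ∈ regularPairs p lam c := by
  have h1' : (c ^ 4 * α ^ 2 * β ^ 2 - lam ^ 4 * (2 * p - 1) ^ 2 : ℂ) ≠ 0 := by exact_mod_cast h1
  have h2' : ((4 * lam ^ 2 * p * (1 - p) - c ^ 2 * (α ^ 2 + β ^ 2)) ^ 2
      - 4 * (c ^ 4 * α ^ 2 * β ^ 2 - lam ^ 4 * (2 * p - 1) ^ 2) : ℂ) ≠ 0 := by exact_mod_cast h2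
  have hb := sq_mul_sq_coeff p lam c α β
  have ha := sq_add_sq_coeff p lam c α β
  rw [← ha, ← hb] at h2'
  rw [← hb] at h1'
  have hAB : coeffA p lam c α β * coeffB p lam c α β ≠ 0 := fun h0 => h2' (by
    linear_combination 16 * (coeffA p lam c α β * coeffB p lam c α β) * h0)
  have hsd := mul_ne_zero_iff.1 h1'
  exact ⟨left_ne_zero_of_mul hAB, right_ne_zero_of_mul hAB, ne_zero_pow two_ne_zero hsd.1,
    ne_zero_pow two_ne_zero hsd.2⟩

open Polynomial in
-- For fixed `β ≠ 0` the two expressions are polynomials in `α` with leading coefficients `c⁴ β²`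
-- and `c⁴`, so each has finitely many roots.
theorem finite_not_mem_regularPairs {p lam c β : ℝ} (hc : c ≠ 0) (hβ : β ≠ 0) :
    {α : ℝ | (α, β) ∉ regularPairs p lam c}.Finite := by
  set P : ℝ[X] := C (c ^ 4 * β ^ 2) * X ^ 2 - C (lam ^ 4 * (2 * p - 1) ^ 2) with hP
  set Q : ℝ[X] := C (c ^ 4) * X ^ 4
    + C (-2 * c ^ 2 * (4 * lam ^ 2 * p * (1 - p) - c ^ 2 * β ^ 2) - 4 * c ^ 4 * β ^ 2) * X ^ 2
    + C ((4 * lam ^ 2 * p * (1 - p) - c ^ 2 * β ^ 2) ^ 2 + 4 * (lam ^ 4 * (2 * p - 1) ^ 2)) with hQ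
  have hP0 : P ≠ 0 := fun h => by
    have : P.coeff 2 = c ^ 4 * β ^ 2 := by
      simp only [hP, coeff_sub, coeff_C_mul, coeff_X_pow, coeff_C]
      norm_num
    rw [h, coeff_zero] at this
    exact (mul_ne_zero (pow_ne_zero 4 hc) (pow_ne_zero 2 hβ)) this.symm
  have hQ0 : Q ≠ 0 := fun h => by
    have : Q.coeff 4 = c ^ 4 := by
      simp only [hQ, coeff_add, coeff_C_mul, coeff_X_pow, coeff_C]
      norm_num
    rw [h, coeff_zero] at this
    exact pow_ne_zero 4 hc this.symm
  refine ((P.rootSet_finite ℝ).union (Q.rootSet_finite ℝ)).subset fun α hα => ?_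
  by_contra hn
  rw [Set.mem_union, not_or] at hn
  refine hα (mem_regularPairs_of_ne (fun h => hn.1 ?_) fun h => hn.2 ?_)
  · rw [mem_rootSet]
    refine ⟨hP0, ?_⟩
    simp [hP]
    linarith
  · rw [mem_rootSet]
    refine ⟨hQ0, ?_⟩
    simp [hQ]
    linarith

theorem dense_regularPairs {p lam c : ℝ} (hc : c ≠ 0) : Dense (regularPairs p lam c) := by
  rw [Metric.dense_iff]
  rintro ⟨α, β⟩ r hr
  obtain ⟨β', hβ', hβr⟩ := (dense_compl_singleton (0 : ℝ)).exists_dist_lt β hr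
  have hfin := finite_not_mem_regularPairs (p := p) (lam := lam) hc hβ'
  obtain ⟨α', hα', hαr⟩ := (dense_univ.sdiff_finite hfin).exists_dist_lt α hr
  refine ⟨(α', β'), ?_, not_not.1 hα'.2⟩
  rw [Metric.mem_ball, dist_comm, Prod.dist_eq]
  exact max_lt hαr hβr

theorem isBackwardSolution_dirCharFun {p lam c α β : ℝ} (h : (α, β) ∈ regularPairs p lam c) :
    IsBackwardSolution p (1 - p) lam (projVelocity c α β) (dirCharFun p lam c α β) where
  init := dirCharFun_zero h
  deriv j r := by
    push_cast
    exact hasDerivAt_dirCharFun h j r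

theorem mainTheorem8 {Ω : Type*} [MeasurableSpace Ω] (μ : Measure Ω) [IsProbabilityMeasure μ]
    (p q lam c : ℝ) (hp : 0 ≤ p) (hq : 0 ≤ q) (hpq : p + q = 1) (hlam : 0 < lam) (hc : 0 < c)
    (J₀ : Ω → ZMod 4) (turn : ℕ → Ω → ZMod 4) (τ : ℕ → Ω → ℝ)
    (hmotion : IsPlanarMotionData μ p q lam J₀ turn τ) :
    -- the formula, wherever its denominators do not vanish
    (∀ t : ℝ, 0 ≤ t → ∀ α β : ℝ, (α, β) ∈ regularPairs p lam c →
      motionCharFun μ c J₀ turn τ α β t = explicitCharFun p lam c α β t) ∧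
    -- at every pair the characteristic function is the limit of the formula along regular pairs,
    -- which are dense
    Dense (regularPairs p lam c) ∧
    (∀ t : ℝ, 0 ≤ t → ∀ α β : ℝ,
      Tendsto (fun z : ℝ × ℝ => explicitCharFun p lam c z.1 z.2 t)
        (𝓝[regularPairs p lam c] (α, β)) (𝓝 (motionCharFun μ c J₀ turn τ α β t))) := by
  obtain rfl : q = 1 - p := by linarith
  have key : ∀ t : ℝ, 0 ≤ t → ∀ α β : ℝ, (α, β) ∈ regularPairs p lam c →
      motionCharFun μ c J₀ turn τ α β t = explicitCharFun p lam c α β t :=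
    fun t ht α β h => by
      rw [(hmotion.motionCharFun_eq hlam hpq (isBackwardSolution_dirCharFun h) ht).2,
        average_dirCharFun h]
  refine ⟨key, dense_regularPairs hc.ne', fun t ht α β => ?_⟩
  have heq : (fun z : ℝ × ℝ => motionCharFun μ c J₀ turn τ z.1 z.2 t)
      =ᶠ[𝓝[regularPairs p lam c] (α, β)] fun z => explicitCharFun p lam c z.1 z.2 t := by
    filter_upwards [self_mem_nhdsWithin] with z hz
    exact key t ht z.1 z.2 hz
  refine Tendsto.congr' heq ?_
  refine tendsto_integral_filter_of_dominated_convergence (fun _ => 1) ?_ ?_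
    (integrable_const _) (ae_of_all _ fun ω => ?_)
  -- Measurability is needed only at regular pairs, where the explicit backward solution provides
  -- it.
  · filter_upwards [self_mem_nhdsWithin] with z hz
    exact (hmotion.motionCharFun_eq hlam hpq
      (isBackwardSolution_dirCharFun (α := z.1) (β := z.2) hz) ht).1
  · refine Eventually.of_forall fun z => ae_of_all _ fun ω => ?_
    rw [mul_comm, Complex.norm_exp_ofReal_mul_I]
  · have hcont : Continuous fun z : ℝ × ℝ => Complex.exp (Complex.I *
        ((z.1 * posX c J₀ turn τ t ω + z.2 * posY c J₀ turn τ t ω : ℝ) : ℂ)) := by fun_prop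
    exact (hcont.tendsto (α, β)).mono_left nhdsWithin_le_nhds
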